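/- **Setting (Property $\mathfrak C$).** Let $(\Omega,\mathcal A,\mu)$ be a probability space and $T:\Omega\to\Omega$ a measurable, $\mu$-preserving and mixing transformation, i.e. $\mu(A\cap T^{-n}B)\to\mu(A)\mu(B)$ for all $A,B\in\mathcal A$. Let $\widehat T:\mathcal L^1(\mu)\to\mathcal L^1(\mu)$ be its transfer operator, determined by $\int \widehat Tf\cdot g\,d\mu=\int f\cdot (g\circ T)\,d\mu$ for all $f\in\mathcal L^1(\mu)$, $g\in\mathcal L^\infty(\mu)$. Let $(\mathcal F,\|\cdot\|)$ be a complex Banach algebra of measurable functions $\Omega\to\mathbb C$ (modulo equality $\mu$-a.e., with pointwise operations) that contains the constant functions, such that $\|f\|\ge |f|_\infty$ for all $f\in\mathcal F$. Suppose that $\widehat T$ maps $\mathcal F$ into itself, is bounded with respect to $\|\cdot\|$, and has a spectral gap on $\mathcal F$: $\widehat T|_{\mathcal F}=\lambda P+N$ with $\lambda\in\mathbb C$ and bounded linear operators $P,N$ on $\mathcal F$ such that $P^2=P$, $\dim \operatorname{Im}P=1$, $PN=NP=0$, and the spectral radius of $N$ is strictly smaller than $|\lambda|$. **Lemma.** Then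 there are constants $K,U>0$ and an integer $N_0\geq 1$ (depending only on $(\Omega,\mathcal A,T,\mu,\mathcal F,\|\cdot\|)$) such that for every real-valued $\varphi\in\mathcal F$, $\varphi\neq 0$, with $\int\varphi\,d\mu=0$, every $u>0$ and every integer $n>N_0$, $$\mu\Big(\max_{i\le n}|S_i\varphi|\ge u\Big)\le K\exp\Big(-U\cdot\frac{u}{\|\varphi\|}\cdot\min\Big\{\frac{u}{n\,|\varphi|_1},\,1\Big\}\Big),$$ where $S_i\varphi=\sum_{k=1}^{i}\varphi\circ T^{k-1}$, $S_0\varphi = 0$, and $|\varphi|_1=\int|\varphi|\,d\mu$. -/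

import Mathlib

open MeasureTheory Filter Topology
open scoped ENNReal

/-- Measure-theoretic (strong) mixing of a transformation `T` with respect to `μ`. -/
def IsMixing {Ω : Type*} [MeasurableSpace Ω] (μ : Measure Ω) (T : Ω → Ω) : Prop :=
  ∀ A B : Set Ω, MeasurableSet A → MeasurableSet B →
    Tendsto (fun n : ℕ => μ (A ∩ T^[n] ⁻¹' B)) atTop (𝓝 (μ A * μ B))

/-- `h = T̂ f` in `L¹(μ)`, where `T̂` is the transfer operator of `T`: both functions are integrable
and `∫ T̂ f · g dμ = ∫ f · (g ∘ T) dμ` for all `g ∈ L^∞(μ)`.  This relation determines `h` up to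
equality almost everywhere, see `IsTransferOf.ae_eq`. -/
def IsTransferOf {Ω : Type*} [MeasurableSpace Ω] (μ : Measure Ω) (T : Ω → Ω) (f h : Ω → ℂ) : Prop :=
  Integrable f μ ∧ Integrable h μ ∧
    ∀ g : Ω → ℂ, MemLp g ∞ μ → ∫ x, h x * g x ∂μ = ∫ x, f x * g (T x) ∂μ

theorem IsTransferOf.ae_eq {Ω : Type*} [MeasurableSpace Ω] {μ : Measure Ω} [IsFiniteMeasure μ]
    {T : Ω → Ω} {f h₁ h₂ : Ω → ℂ} (H₁ : IsTransferOf μ T f h₁) (H₂ : IsTransferOf μ T f h₂) :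
    h₁ =ᵐ[μ] h₂ := by
  refine H₁.2.1.ae_eq_of_forall_setIntegral_eq h₁ h₂ H₂.2.1 fun s hs _ => ?_
  have hg : MemLp (s.indicator fun _ => (1 : ℂ)) ∞ μ := (memLp_const 1).indicator hs
  have key := (H₁.2.2 _ hg).trans (H₂.2.2 _ hg).symm
  have aux : ∀ h : Ω → ℂ, (∫ x, h x * s.indicator (fun _ => (1 : ℂ)) x ∂μ) = ∫ x in s, h x ∂μ := by
    intro h
    rw [← integral_indicator hs]
    congr 1
    ext x
    by_cases hx : x ∈ s <;> simp [hx]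
  rwa [aux, aux] at key

/-- A bounded operator `U` on a complex Banach space has a spectral gap if `U = c P + N` where `P`
is a projection onto a one-dimensional space, `ρ(N) < |c|` and `P N = N P = 0`. -/
def HasSpectralGap {F : Type*} [NormedAddCommGroup F] [NormedSpace ℂ F] (U : F →L[ℂ] F) : Prop :=
  ∃ (c : ℂ) (P N : F →L[ℂ] F),
    U = c • P + N ∧
    P ∘L P = P ∧
    Module.finrank ℂ (LinearMap.range (P : F →ₗ[ℂ] F)) = 1 ∧
    spectralRadius ℂ N < ‖c‖ₑ ∧
    P ∘L N = 0 ∧ N ∘L P = 0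

/-- Property `𝔠` of `(Ω, 𝒜, T, μ, F, ‖·‖)`.  Here `F` is a complex Banach algebra; the injective
linear map `ι`, which takes products to pointwise products, exhibits `F` as an algebra of
(`μ`-a.e. classes of) measurable functions. -/
structure PropertyC {Ω : Type*} [MeasurableSpace Ω] (μ : Measure Ω) (T : Ω → Ω)
    (F : Type*) [NormedRing F] [NormedAlgebra ℂ F] [CompleteSpace F]
    (ι : F →ₗ[ℂ] (Ω →ₘ[μ] ℂ)) : Prop where
  injective : Function.Injective ι
  map_mul : ∀ f g : F, ι (f * g) = ι f * ι g
  /-- `F` contains the constant function `1`, hence (by linearity) all constant functions.  As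
  `ι` takes products to products, that function is the unit of the algebra `F`. -/
  map_one : ι 1 = 1
  isProbabilityMeasure : IsProbabilityMeasure μ
  measurePreserving : MeasurePreserving T μ μ
  mixing : IsMixing μ T
  /-- `‖f‖ ≥ |f|_∞`. -/
  eLpNorm_top_le : ∀ f : F, eLpNorm (ι f) ∞ μ ≤ ‖f‖ₑ
  /-- The transfer operator maps `F` into itself, is bounded for `‖·‖`, and has a spectral gap
  on `F`. -/
  transfer : ∃ L : F →L[ℂ] F, (∀ f : F, IsTransferOf μ T (ι f) (ι (L f))) ∧ HasSpectralGap L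

/-! The proof combines martingale approximation with an exponential moment estimate. Duality against
`1` makes `1` a fixed vector of `L`, so the spectral gap gives `L g = (∫ g) 1 + N g` with `N ^ k`
exponentially small (`exists_spectral_decomposition`). For `φ` of mean zero the Neumann series `g =
∑ N ^ k φ` solves `φ = g - L g`, and `ψ = g - (L g) ∘ T` is a reverse martingale difference. Up to a
bounded boundary term, `S_n φ` is `S_n ψ`, so Doob's inequality bounds the maximum by the
exponential moments of the last sum. Those moments are `a n = ∫ (L_t)^n 1` with `L_t v = L (e^{tφ}
v)`. Instead of perturbing the leading eigenvalue, one writes `(L_t)^n 1 = a n • 1 + w n` and shows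
`‖w n‖ ≤ const * |t| ‖φ‖ a n`. As `φ` and `w n` have mean zero, `a (n + 1) / a n ≤ 1 + D t² ‖φ‖
|φ|₁`. One factor is measured in `L¹`, which is the source of `n |φ|₁` in the result. Choosing `t`
proportional to `min (u / (n |φ|₁)) 1 / ‖φ‖` concludes. -/

/-! ### Maximal inequality for reverse martingales and coboundary perturbations. -/

section MaximalInequality

variable {Ω : Type*}

/-- The points `x` for which `u ≤ S_{n - i} ψ (T^i x)` for some `i ≤ n`, where `u > 0`. -/
def tailExceedance (T : Ω → Ω) (ψ : Ω → ℝ) (u : ℝ) : ℕ → Set Ω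
  | 0 => {_x | u ≤ 0}
  | n + 1 => T ⁻¹' tailExceedance T ψ u n ∪ {x | u ≤ birkhoffSum T ψ (n + 1) x}

theorem mem_tailExceedance {T : Ω → Ω} {ψ : Ω → ℝ} {u : ℝ} {n i : ℕ} (hi : i ≤ n) {x : Ω}
    (h : u ≤ birkhoffSum T ψ (n - i) (T^[i] x)) : x ∈ tailExceedance T ψ u n := by
  induction n generalizing i x with
  | zero =>
    obtain rfl : i = 0 := by omega
    simpa [tailExceedance] using h
  | succ n ih =>
    cases i with
    | zero => exact Or.inr (by simpa using h)
    | succ i =>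
      refine Or.inl (ih (i := i) (by omega) ?_)
      simpa [Nat.succ_sub_succ] using h

theorem abs_birkhoffSum_le {T : Ω → Ω} {ψ : Ω → ℝ} {b : ℝ} (hb : ∀ x, |ψ x| ≤ b) (n : ℕ) (x : Ω) :
    |birkhoffSum T ψ n x| ≤ n * b := by
  refine (Finset.abs_sum_le_sum_abs _ _).trans ?_
  refine (Finset.sum_le_sum fun i _ => hb _).trans ?_
  simp

/-- Writes `G - H = (G - H ∘ T) + (H ∘ T - H)`; the second bracket telescopes. -/
theorem birkhoffSum_sub_coboundary (T : Ω → Ω) (G H : Ω → ℝ) (n : ℕ) (x : Ω) :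
    birkhoffSum T (fun x => G x - H x) n x =
      birkhoffSum T (fun x => G x - H (T x)) n x + (H (T^[n] x) - H x) := by
  induction n with
  | zero => simp
  | succ n ih =>
    rw [birkhoffSum_succ, birkhoffSum_succ, ih, Function.iterate_succ_apply']
    ring

variable [MeasurableSpace Ω]

theorem measurable_birkhoffSum {T : Ω → Ω} (hT : Measurable T) {ψ : Ω → ℝ} (hψ : Measurable ψ)
    (n : ℕ) : Measurable (birkhoffSum T ψ n) := by
  unfold birkhoffSum
  exact Finset.measurable_sum _ fun i _ => hψ.comp (hT.iterate i)

theorem measurableSet_tailExceedance {T : Ω → Ω} (hT : Measurable T) {ψ : Ω → ℝ}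
    (hψ : Measurable ψ) (u : ℝ) (n : ℕ) : MeasurableSet (tailExceedance T ψ u n) := by
  induction n with
  | zero => exact MeasurableSet.const _
  | succ n ih => exact (hT ih).union (measurableSet_le measurable_const
      (measurable_birkhoffSum hT hψ _))

variable {μ : Measure Ω}

theorem MeasureTheory.MeasurePreserving.integral_comp_of_aestronglyMeasurable
    {E : Type*} [NormedAddCommGroup E] [NormedSpace ℝ E] {T : Ω → Ω}
    (hT : MeasurePreserving T μ μ) {f : Ω → E} (hf : AEStronglyMeasurable f μ) :
    ∫ x, f (T x) ∂μ = ∫ x, f x ∂μ := by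
  have h := integral_map hT.measurable.aemeasurable (hT.map_eq.symm ▸ hf)
  rw [hT.map_eq] at h
  exact h.symm

variable [IsProbabilityMeasure μ]
theorem integrable_of_abs_le {f : Ω → ℝ} (hf : Measurable f) {b : ℝ} (hb : ∀ x, |f x| ≤ b) :
    Integrable f μ :=
  Integrable.of_bound hf.aestronglyMeasurable b (ae_of_all _ hb)

theorem integrable_exp_of_abs_le {f : Ω → ℝ} (hf : Measurable f) {b : ℝ} (hb : ∀ x, |f x| ≤ b) :
    Integrable (fun x => Real.exp (f x)) μ :=
  integrable_of_abs_le (b := Real.exp b) (Real.measurable_exp.comp hf) fun x => by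
    rw [abs_of_pos (Real.exp_pos _)]
    exact Real.exp_le_exp.2 ((le_abs_self _).trans (hb x))

/-- Doob's maximal inequality for the exponential of the reverse martingale `S_{n-i} ψ ∘ T^i`. -/
theorem exp_mul_measureReal_tailExceedance_le {T : Ω → Ω} (hT : MeasurePreserving T μ μ)
    {ψ : Ω → ℝ} (hψ : Measurable ψ) {b : ℝ} (hb : ∀ x, |ψ x| ≤ b)
    (hmart : ∀ W : Ω → ℝ, Measurable W → (∃ c, ∀ x, |W x| ≤ c) → ∫ x, ψ x * W (T x) ∂μ = 0)
    (u t : ℝ) (ht : 0 ≤ t) (n : ℕ) :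
    Real.exp (t * u) * μ.real (tailExceedance T ψ u n) ≤
      ∫ x in tailExceedance T ψ u n, Real.exp (t * birkhoffSum T ψ n x) ∂μ := by
  have hSm := measurable_birkhoffSum hT.measurable hψ
  have hEm := measurableSet_tailExceedance hT.measurable hψ u
  have hXm : ∀ n, Measurable fun x => Real.exp (t * birkhoffSum T ψ n x) := fun n =>
    Real.measurable_exp.comp ((hSm n).const_mul t)
  have hbd : ∀ n x, |t * birkhoffSum T ψ n x| ≤ t * (n * b) := fun n x => by
    rw [abs_mul, abs_of_nonneg ht]
    exact mul_le_mul_of_nonneg_left (abs_birkhoffSum_le hb n x) ht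
  have hXi : ∀ n, Integrable (fun x => Real.exp (t * birkhoffSum T ψ n x)) μ := fun n =>
    integrable_exp_of_abs_le ((hSm n).const_mul t) (hbd n)
  induction n with
  | zero =>
    by_cases hu : u ≤ 0
    · have : tailExceedance T ψ u 0 = Set.univ := by ext; simp [tailExceedance, hu]
      rw [this]
      simpa using mul_nonpos_of_nonneg_of_nonpos ht hu
    · have : tailExceedance T ψ u 0 = ∅ := by ext; simp [tailExceedance, hu]
      simp [this]
  | succ n ih =>
    set E := tailExceedance T ψ u n with hE
    -- Split by the martingale's stopping time: on `D` only the newest, full-length sum exceeds `u`.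
    set D : Set Ω := {x | u ≤ birkhoffSum T ψ (n + 1) x} \ T ⁻¹' E with hD
    have hDm : MeasurableSet D :=
      (measurableSet_le measurable_const (hSm _)).diff (hT.measurable (hEm n))
    have hdisj : Disjoint (T ⁻¹' E) D := Set.disjoint_sdiff_right
    have hsplit : tailExceedance T ψ u (n + 1) = T ⁻¹' E ∪ D := by
      rw [hD, Set.union_sdiff_self]; rfl
    rw [hsplit, measureReal_union hdisj hDm, setIntegral_union hdisj hDm
      (hXi _).integrableOn (hXi _).integrableOn, mul_add]
    refine add_le_add ?_ ?_
    · have h1 : μ.real (T ⁻¹' E) = μ.real E := by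
        rw [measureReal_def, hT.measure_preimage (hEm n).nullMeasurableSet, measureReal_def]
      rw [h1]
      refine ih.trans ?_
      set W : Ω → ℝ := E.indicator fun x => Real.exp (t * birkhoffSum T ψ n x) with hW
      have hWm : Measurable W := (hXm n).indicator (hEm n)
      have hW0 : ∀ x, 0 ≤ W x := fun x => Set.indicator_nonneg (fun _ _ => (Real.exp_pos _).le) x
      have hWb : ∀ x, |W x| ≤ Real.exp (t * (n * b)) := fun x => by
        rw [abs_of_nonneg (hW0 x)]
        refine Set.indicator_apply_le' (fun _ => ?_) fun _ => (Real.exp_pos _).le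
        exact Real.exp_le_exp.2 ((le_abs_self _).trans (hbd n x))
      have hWT : Integrable (fun x => W (T x)) μ :=
        integrable_of_abs_le (hWm.comp hT.measurable) fun x => hWb _
      have hψW : Integrable (fun x => ψ x * W (T x)) μ := by
        refine integrable_of_abs_le (hψ.mul (hWm.comp hT.measurable))
          (b := b * Real.exp (t * (n * b))) fun x => ?_
        rw [abs_mul]
        exact mul_le_mul (hb x) (hWb _) (abs_nonneg _) ((abs_nonneg _).trans (hb x))
      calc ∫ x in E, Real.exp (t * birkhoffSum T ψ n x) ∂μ
          = ∫ x, W (T x) ∂μ := by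
            rw [hT.integral_comp_of_aestronglyMeasurable hWm.aestronglyMeasurable, hW, integral_indicator (hEm n)]
        -- The added term has integral zero; with `1 + tψ ≤ exp (tψ)` this replaces Jensen's
        -- inequality for conditional expectations.
        _ = ∫ x, (W (T x) + t * (ψ x * W (T x))) ∂μ := by
            rw [integral_add hWT (hψW.const_mul t), integral_const_mul, hmart W hWm ⟨_, hWb⟩]
            simp
        _ ≤ ∫ x, (T ⁻¹' E).indicator (fun x => Real.exp (t * birkhoffSum T ψ (n + 1) x)) x ∂μ := by
            refine integral_mono (hWT.add (hψW.const_mul t))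
              ((hXi (n + 1)).indicator (hT.measurable (hEm n))) fun x => ?_
            by_cases hx : T x ∈ E
            · have hx' : x ∈ T ⁻¹' E := hx
              simp only [hW, Set.indicator_of_mem hx, Set.indicator_of_mem hx',
                birkhoffSum_succ', mul_add, Real.exp_add]
              nlinarith [Real.add_one_le_exp (t * ψ x), Real.exp_pos (t * birkhoffSum T ψ n (T x))]
            · have hx' : x ∉ T ⁻¹' E := hx
              simp [hW, Set.indicator_of_notMem hx, Set.indicator_of_notMem hx']
        _ = _ := integral_indicator (hT.measurable (hEm n))
    · have := setIntegral_mono_on (μ := μ) (s := D) (f := fun _ => Real.exp (t * u))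
        (integrable_const _).integrableOn (hXi (n + 1)).integrableOn hDm
        (fun x hx => Real.exp_le_exp.2 (mul_le_mul_of_nonneg_left hx.1 ht))
      simpa [mul_comm] using this

theorem measureReal_tailExceedance_le {T : Ω → Ω} (hT : MeasurePreserving T μ μ)
    {ψ : Ω → ℝ} (hψ : Measurable ψ) {b : ℝ} (hb : ∀ x, |ψ x| ≤ b)
    (hmart : ∀ W : Ω → ℝ, Measurable W → (∃ c, ∀ x, |W x| ≤ c) → ∫ x, ψ x * W (T x) ∂μ = 0)
    (u t : ℝ) (ht : 0 ≤ t) (n : ℕ) :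
    μ.real (tailExceedance T ψ u n) ≤
      Real.exp (-(t * u)) * ∫ x, Real.exp (t * birkhoffSum T ψ n x) ∂μ := by
  have h := exp_mul_measureReal_tailExceedance_le hT hψ hb hmart u t ht n
  have h2 : ∫ x in tailExceedance T ψ u n, Real.exp (t * birkhoffSum T ψ n x) ∂μ ≤
      ∫ x, Real.exp (t * birkhoffSum T ψ n x) ∂μ := by
    refine setIntegral_le_integral (integrable_exp_of_abs_le (b := t * (n * b))
      ((measurable_birkhoffSum hT.measurable hψ n).const_mul t) fun x => ?_)
      (ae_of_all _ fun x => (Real.exp_pos _).le)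
    rw [abs_mul, abs_of_nonneg ht]
    exact mul_le_mul_of_nonneg_left (abs_birkhoffSum_le hb n x) ht
  rw [Real.exp_neg, inv_mul_eq_div, le_div_iff₀ (Real.exp_pos _), mul_comm]
  exact h.trans h2

/-- If `f = G - H` with `E[G | T⁻¹ 𝒜] = H ∘ T`, then the maximum of the Birkhoff sums of `f` is
controlled by the exponential moments of the last one. -/
theorem measureReal_le_sup'_abs_birkhoffSum_le {T : Ω → Ω} (hT : MeasurePreserving T μ μ)
    {G H : Ω → ℝ} (hG : Measurable G) (hH : Measurable H) {a B : ℝ} (hGa : ∀ x, |G x| ≤ a)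
    (hHB : ∀ x, |H x| ≤ B)
    (hmart : ∀ W : Ω → ℝ, Measurable W → (∃ c, ∀ x, |W x| ≤ c) →
      ∫ x, G x * W (T x) ∂μ = ∫ x, H x * W x ∂μ)
    (u t : ℝ) (ht : 0 ≤ t) (n : ℕ) :
    μ.real {x | u ≤ (Finset.range (n + 1)).sup' Finset.nonempty_range_add_one
      (fun i => |birkhoffSum T (fun x => G x - H x) i x|)} ≤
      Real.exp (4 * t * B - t * u / 2) *
        (∫ x, Real.exp (t * birkhoffSum T (fun x => G x - H x) n x) ∂μ +
          ∫ x, Real.exp (-t * birkhoffSum T (fun x => G x - H x) n x) ∂μ) := by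
  set f : Ω → ℝ := fun x => G x - H x with hf
  set ψ : Ω → ℝ := fun x => G x - H (T x) with hψdef
  have hψm : Measurable ψ := hG.sub (hH.comp hT.measurable)
  have hfm : Measurable f := hG.sub hH
  have hψb : ∀ x, |ψ x| ≤ a + B := fun x =>
    (abs_sub _ _).trans (add_le_add (hGa x) (hHB _))
  have hfb : ∀ x, |f x| ≤ a + B := fun x =>
    (abs_sub _ _).trans (add_le_add (hGa x) (hHB _))
  have hmart' : ∀ W : Ω → ℝ, Measurable W → (∃ c, ∀ x, |W x| ≤ c) →
      ∫ x, ψ x * W (T x) ∂μ = 0 := by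
    rintro W hW ⟨c, hc⟩
    have hi1 : Integrable (fun x => G x * W (T x)) μ := by
      refine integrable_of_abs_le (hG.mul (hW.comp hT.measurable)) (b := a * c) fun x => ?_
      rw [abs_mul]
      exact mul_le_mul (hGa x) (hc _) (abs_nonneg _) ((abs_nonneg _).trans (hGa x))
    have hi2 : Integrable (fun x => H (T x) * W (T x)) μ := by
      refine integrable_of_abs_le ((hH.comp hT.measurable).mul (hW.comp hT.measurable))
        (b := B * c) fun x => ?_
      rw [abs_mul]
      exact mul_le_mul (hHB _) (hc _) (abs_nonneg _) ((abs_nonneg _).trans (hHB x))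
    have : ∫ x, H (T x) * W (T x) ∂μ = ∫ x, H x * W x ∂μ :=
      hT.integral_comp_of_aestronglyMeasurable (hH.mul hW).aestronglyMeasurable
    simp only [hψdef, sub_mul]
    rw [integral_sub hi1 hi2, this, hmart W hW ⟨c, hc⟩, sub_self]
  have hrel : ∀ n x, birkhoffSum T f n x = birkhoffSum T ψ n x + (H (T^[n] x) - H x) :=
    birkhoffSum_sub_coboundary T G H
  have hneg : ∀ n x, birkhoffSum T (fun x => -ψ x) n x = - birkhoffSum T ψ n x := fun n x => by
    simp [birkhoffSum]
  -- The boundary term `H ∘ T^n - H` is at most `2B`, which costs a factor `exp (2tB)`.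
  have key : ∀ s : ℝ, |s| = t → ∫ x, Real.exp (s * birkhoffSum T ψ n x) ∂μ ≤
      Real.exp (2 * t * B) * ∫ x, Real.exp (s * birkhoffSum T f n x) ∂μ := by
    intro s hs
    rw [← integral_const_mul]
    have hb' : ∀ g : Ω → ℝ, (∀ x, |g x| ≤ a + B) → ∀ x,
        |s * birkhoffSum T g n x| ≤ t * (n * (a + B)) := fun g hg x => by
      rw [abs_mul, hs]
      exact mul_le_mul_of_nonneg_left (abs_birkhoffSum_le hg n x) ht
    refine integral_mono (integrable_exp_of_abs_le
        ((measurable_birkhoffSum hT.measurable hψm n).const_mul s) (hb' ψ hψb))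
      ((integrable_exp_of_abs_le
        ((measurable_birkhoffSum hT.measurable hfm n).const_mul s) (hb' f hfb)).const_mul _)
      fun x => ?_
    simp only
    rw [← Real.exp_add]
    refine Real.exp_le_exp.2 ?_
    have h1 : |s * (H (T^[n] x) - H x)| ≤ t * (B + B) := by
      rw [abs_mul, hs]
      exact mul_le_mul_of_nonneg_left
        ((abs_sub _ _).trans (add_le_add (hHB _) (hHB _))) ht
    rw [hrel]
    have := neg_abs_le (s * (H (T^[n] x) - H x))
    linarith
  have hsub : {x | u ≤ (Finset.range (n + 1)).sup' Finset.nonempty_range_add_one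
      (fun i => |birkhoffSum T f i x|)} ⊆
      tailExceedance T ψ (u / 2 - 2 * B) n ∪
        tailExceedance T (fun x => -ψ x) (u / 2 - 2 * B) n := by
    intro x hx
    rw [Set.mem_ofPred_eq, Finset.le_sup'_iff] at hx
    obtain ⟨i, hi, hxi⟩ := hx
    have hin : i ≤ n := by simpa [Nat.lt_succ_iff] using hi
    -- `S_i = S_n - S_{n-i} ∘ T^i`, so one of the two tail sums is at least `u / 2` in absolute
    -- value.
    have hex : ∃ j ≤ n, u / 2 ≤ |birkhoffSum T f (n - j) (T^[j] x)| := by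
      by_contra! hcon
      have h0 := hcon 0 (Nat.zero_le _)
      have h1 := hcon i hin
      have hadd := birkhoffSum_add T f i (n - i) x
      rw [Nat.add_sub_cancel' hin] at hadd
      simp only [Nat.sub_zero, Function.iterate_zero, id] at h0
      have := abs_sub (birkhoffSum T f n x) (birkhoffSum T f (n - i) (T^[i] x))
      rw [hadd, add_sub_cancel_right, ← hadd] at this
      linarith
    obtain ⟨j, hj, hxj⟩ := hex
    have h1 : u / 2 - 2 * B ≤ |birkhoffSum T ψ (n - j) (T^[j] x)| := by
      rw [hrel] at hxj
      have h2 := abs_add_le (birkhoffSum T ψ (n - j) (T^[j] x))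
        (H (T^[n - j] (T^[j] x)) - H (T^[j] x))
      have h3 := abs_sub (H (T^[n - j] (T^[j] x))) (H (T^[j] x))
      have h4 := hHB (T^[n - j] (T^[j] x))
      have h5 := hHB (T^[j] x)
      linarith
    rcases le_abs.1 h1 with h | h
    · exact Or.inl (mem_tailExceedance hj h)
    · exact Or.inr (mem_tailExceedance hj (by rwa [hneg]))
  refine (measureReal_mono hsub).trans ((measureReal_union_le _ _).trans ?_)
  have e1 := measureReal_tailExceedance_le hT hψm hψb hmart' (u / 2 - 2 * B) t ht n
  have e2 := measureReal_tailExceedance_le hT hψm.neg (fun x => by simpa using hψb x)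
    (fun W hW hc => by simp [integral_neg, hmart' W hW hc]) (u / 2 - 2 * B) t ht n
  have k1 := key t (abs_of_nonneg ht)
  have k2 := key (-t) (by rw [abs_neg, abs_of_nonneg ht])
  have e2' : (fun x => Real.exp (t * birkhoffSum T (-ψ) n x)) =
      fun x => Real.exp (-t * birkhoffSum T ψ n x) := by
    ext x
    rw [show birkhoffSum T (-ψ) n x = _ from hneg n x]
    ring_nf
  rw [e2'] at e2
  -- Half of `4tB` comes from lowering the threshold to `u / 2 - 2B`, half from `key`.
  have hexp : Real.exp (4 * t * B - t * u / 2) =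
      Real.exp (-(t * (u / 2 - 2 * B))) * Real.exp (2 * t * B) := by
    rw [← Real.exp_add]; ring_nf
  rw [hexp, mul_assoc, mul_add, mul_add]
  exact add_le_add (e1.trans (mul_le_mul_of_nonneg_left k1 (Real.exp_pos _).le))
    (e2.trans (mul_le_mul_of_nonneg_left k2 (Real.exp_pos _).le))

end MaximalInequality

/-! ### Spectral decomposition of the transfer operator. -/

section SpectralGap

/-- Operators of spectral radius less than `1` have exponentially decaying powers. -/
theorem exists_norm_pow_le_of_spectralRadius_lt_one {A : Type*} [NormedRing A] [NormedAlgebra ℂ A]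
    [CompleteSpace A] {a : A} (ha : spectralRadius ℂ a < 1) :
    ∃ C r : ℝ, 0 < C ∧ 0 < r ∧ r < 1 ∧ ∀ k, ‖a ^ k‖ ≤ C * r ^ k := by
  obtain ⟨r, hr, hr1⟩ := ENNReal.lt_iff_exists_nnreal_btwn.1 ha
  have hr1' : r < 1 := by exact_mod_cast hr1
  have hr0 : 0 < r := by
    have : (0 : ℝ≥0∞) < r := bot_le.trans_lt hr
    exact_mod_cast this
  -- Gelfand's formula bounds all large powers; the finitely many others go into the constant.
  have hev := (spectrum.pow_nnnorm_pow_one_div_tendsto_nhds_spectralRadius a).eventually_lt_const hr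
  obtain ⟨m, hm⟩ := eventually_atTop.1 (hev.and (eventually_ge_atTop 1))
  have hlarge : ∀ k ≥ m, ‖a ^ k‖ ≤ (r : ℝ) ^ k := by
    intro k hk
    obtain ⟨h1, h2⟩ := hm k hk
    have h3 : ((‖a ^ k‖₊ : ℝ≥0∞) ^ (1 / (k : ℝ))) ^ (k : ℝ) ≤ (r : ℝ≥0∞) ^ (k : ℝ) :=
      ENNReal.rpow_le_rpow h1.le (Nat.cast_nonneg _)
    have hk0 : (k : ℝ) ≠ 0 := by positivity
    rw [← ENNReal.rpow_mul, one_div, inv_mul_cancel₀ hk0, ENNReal.rpow_one,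
      ENNReal.rpow_natCast] at h3
    exact_mod_cast h3
  refine ⟨1 + ∑ k ∈ Finset.range m, ‖a ^ k‖ / (r : ℝ) ^ k, r, ?_, by exact_mod_cast hr0,
    by exact_mod_cast hr1', fun k => ?_⟩
  · positivity
  · have hrk : (0 : ℝ) < (r : ℝ) ^ k := by positivity
    by_cases hk : m ≤ k
    · refine (hlarge k hk).trans (le_mul_of_one_le_left hrk.le ?_)
      exact le_add_of_nonneg_right (Finset.sum_nonneg fun i _ => by positivity)
    · rw [← div_le_iff₀ hrk]
      have := Finset.single_le_sum (f := fun k => ‖a ^ k‖ / (r : ℝ) ^ k)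
        (fun i _ => by positivity) (Finset.mem_range.2 (not_le.1 hk))
      linarith

namespace PropertyC

variable {Ω : Type*} [MeasurableSpace Ω] {μ : Measure Ω} {T : Ω → Ω}
  {F : Type*} [NormedRing F] [NormedAlgebra ℂ F] [CompleteSpace F] {ι : F →ₗ[ℂ] (Ω →ₘ[μ] ℂ)}

theorem ae_norm_le (hC : PropertyC μ T F ι) (g : F) : ∀ᵐ x ∂μ, ‖ι g x‖ ≤ ‖g‖ := by
  have h := hC.eLpNorm_top_le g
  rw [eLpNorm_exponent_top] at h
  filter_upwards [ae_le_eLpNormEssSup (f := ι g) (μ := μ)] with x hx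
  have := hx.trans h
  rwa [enorm_le_iff_norm_le] at this

theorem coeFn_one (hC : PropertyC μ T F ι) : ∀ᵐ x ∂μ, ι 1 x = 1 := by
  rw [hC.map_one]
  exact AEEqFun.coeFn_one

theorem coeFn_mul (hC : PropertyC μ T F ι) (g h : F) : ∀ᵐ x ∂μ, ι (g * h) x = ι g x * ι h x := by
  rw [hC.map_mul]
  exact AEEqFun.coeFn_mul _ _

theorem coeFn_add (_hC : PropertyC μ T F ι) (g h : F) : ∀ᵐ x ∂μ, ι (g + h) x = ι g x + ι h x := by
  rw [map_add]
  exact AEEqFun.coeFn_add _ _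

theorem coeFn_sub (_hC : PropertyC μ T F ι) (g h : F) : ∀ᵐ x ∂μ, ι (g - h) x = ι g x - ι h x := by
  rw [map_sub]
  exact AEEqFun.coeFn_sub _ _

theorem coeFn_smul (_hC : PropertyC μ T F ι) (c : ℂ) (g : F) :
    ∀ᵐ x ∂μ, ι (c • g) x = c * ι g x := by
  rw [map_smul]
  exact AEEqFun.coeFn_smul _ _

theorem memLp_top (hC : PropertyC μ T F ι) (g : F) : MemLp (ι g) ∞ μ :=
  ⟨(ι g).aestronglyMeasurable, (hC.eLpNorm_top_le g).trans_lt enorm_lt_top⟩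

theorem integrable (hC : PropertyC μ T F ι) (g : F) : Integrable (ι g) μ :=
  have := hC.isProbabilityMeasure
  Integrable.of_bound (ι g).aestronglyMeasurable _ (hC.ae_norm_le g)

theorem one_ne_zero (hC : PropertyC μ T F ι) : (1 : F) ≠ 0 := by
  have := hC.isProbabilityMeasure
  intro h
  have h1 := hC.coeFn_one
  rw [h, map_zero] at h1
  have h2 : ∀ᵐ x ∂μ, (0 : Ω →ₘ[μ] ℂ) x = 0 := AEEqFun.coeFn_zero
  obtain ⟨x, hx1, hx2⟩ := (h1.and h2).exists
  rw [hx2] at hx1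
  exact zero_ne_one hx1

theorem eq_zero_of_integral_norm_sq (hC : PropertyC μ T F ι) {g : F}
    (h : ∫ x, ‖ι g x‖ ^ 2 ∂μ = 0) : g = 0 := by
  have := hC.isProbabilityMeasure
  have hi : Integrable (fun x => ‖ι g x‖ ^ 2) μ := by
    refine Integrable.of_bound ((ι g).aestronglyMeasurable.norm.pow 2) (‖g‖ ^ 2) ?_
    filter_upwards [hC.ae_norm_le g] with x hx
    rw [Real.norm_of_nonneg (by positivity)]
    exact pow_le_pow_left₀ (norm_nonneg _) hx 2
  rw [integral_eq_zero_iff_of_nonneg (fun x => by positivity) hi] at h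
  refine hC.injective (AEEqFun.ext ?_)
  rw [map_zero]
  filter_upwards [h, AEEqFun.coeFn_zero (β := ℂ) (μ := μ)] with x hx h0
  rw [h0]
  simpa using hx

/-- Eigenvalues of the transfer operator lie in the closed unit disc. -/
theorem norm_le_one_of_eigenvector (hC : PropertyC μ T F ι) {L : F →L[ℂ] F}
    (hL : ∀ g : F, IsTransferOf μ T (ι g) (ι (L g))) {p : F} (hp : p ≠ 0) {c : ℂ}
    (hc : L p = c • p) : ‖c‖ ≤ 1 := by
  have := hC.isProbabilityMeasure
  have hT := hC.measurePreserving
  -- Test against the conjugate of `p`: `c ∫ |p|² = ∫ p · conj (p ∘ T)`, and the right side is at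
  -- most `∫ |p|²` by `2ab ≤ a² + b²` and invariance of `μ`.
  have hq : MemLp (fun x => (starRingEnd ℂ) (ι p x)) ∞ μ := (hC.memLp_top p).star
  have key := (hL p).2.2 _ hq
  have hTi : ∀ᵐ x ∂μ, ‖ι p (T x)‖ ≤ ‖p‖ := hT.quasiMeasurePreserving.ae (hC.ae_norm_le p)
  have hsm : AEStronglyMeasurable (fun x => ι p (T x)) μ :=
    (ι p).aestronglyMeasurable.comp_measurePreserving hT
  have hi : Integrable (fun x => ‖ι p x‖ ^ 2) μ := by
    refine Integrable.of_bound ((ι p).aestronglyMeasurable.norm.pow 2) (‖p‖ ^ 2) ?_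
    filter_upwards [hC.ae_norm_le p] with x hx
    rw [Real.norm_of_nonneg (by positivity)]
    exact pow_le_pow_left₀ (norm_nonneg _) hx 2
  have hiT : Integrable (fun x => ‖ι p (T x)‖ ^ 2) μ := by
    refine Integrable.of_bound (hsm.norm.pow 2) (‖p‖ ^ 2) ?_
    filter_upwards [hTi] with x hx
    rw [Real.norm_of_nonneg (by positivity)]
    exact pow_le_pow_left₀ (norm_nonneg _) hx 2
  set J := ∫ x, ‖ι p x‖ ^ 2 ∂μ with hJ
  have hJT : ∫ x, ‖ι p (T x)‖ ^ 2 ∂μ = J :=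
    hT.integral_comp_of_aestronglyMeasurable ((ι p).aestronglyMeasurable.norm.pow 2)
  have hJ0 : 0 < J := by
    refine lt_of_le_of_ne (integral_nonneg fun x => by positivity) fun h => hp ?_
    exact hC.eq_zero_of_integral_norm_sq h.symm
  have h1 : ∫ x, ι (L p) x * (starRingEnd ℂ) (ι p x) ∂μ = c * J := by
    rw [hc, hJ, ← integral_complex_ofReal, ← integral_const_mul]
    refine integral_congr_ae ?_
    filter_upwards [hC.coeFn_smul c p] with x hx
    rw [hx, mul_assoc, Complex.mul_conj']
    simp
  rw [h1] at key
  have h2 : ‖c‖ * J ≤ J := by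
    calc ‖c‖ * J = ‖c * (J : ℂ)‖ := by simp [abs_of_pos hJ0]
      _ ≤ ∫ x, ‖ι p x * (starRingEnd ℂ) (ι p (T x))‖ ∂μ := by
        rw [key]; exact norm_integral_le_integral_norm _
      _ ≤ ∫ x, (‖ι p x‖ ^ 2 + ‖ι p (T x)‖ ^ 2) / 2 ∂μ := by
        refine integral_mono_of_nonneg (ae_of_all _ fun x => norm_nonneg _)
          ((hi.add hiT).div_const 2) (ae_of_all _ fun x => ?_)
        simp only [norm_mul, RCLike.norm_conj]
        nlinarith [sq_nonneg (‖ι p x‖ - ‖ι p (T x)‖)]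
      _ = J := by
        rw [integral_div, integral_add hi hiT, hJT]; ring
  exact le_of_mul_le_mul_right (by linarith) hJ0

theorem integral_transfer (_hC : PropertyC μ T F ι) {L : F →L[ℂ] F}
    (hL : ∀ g : F, IsTransferOf μ T (ι g) (ι (L g))) (g : F) :
    ∫ x, ι (L g) x ∂μ = ∫ x, ι g x ∂μ := by
  simpa using (hL g).2.2 (fun _ => 1) (memLp_top_const _)

/-- This is the invariance of `μ` in dual form. -/
theorem transfer_one (hC : PropertyC μ T F ι) {L : F →L[ℂ] F}
    (hL : ∀ g : F, IsTransferOf μ T (ι g) (ι (L g))) : L 1 = 1 := by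
  have := hC.isProbabilityMeasure
  have hT := hC.measurePreserving
  refine hC.injective (AEEqFun.ext ((hL 1).ae_eq ⟨hC.integrable 1, hC.integrable 1, fun g hg => ?_⟩))
  have h1 : ∫ x, ι 1 x * g x ∂μ = ∫ x, g x ∂μ := integral_congr_ae (by
    filter_upwards [hC.coeFn_one] with x hx
    rw [hx, one_mul])
  have h2 : ∫ x, ι 1 x * g (T x) ∂μ = ∫ x, g (T x) ∂μ := integral_congr_ae (by
    filter_upwards [hC.coeFn_one] with x hx
    rw [hx, one_mul])
  rw [h1, h2, hT.integral_comp_of_aestronglyMeasurable hg.1]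

theorem integral_add_smul (hC : PropertyC μ T F ι) (c : ℂ) (g h : F) :
    ∫ x, ι (c • g + h) x ∂μ = c * ∫ x, ι g x ∂μ + ∫ x, ι h x ∂μ := by
  rw [← integral_const_mul, ← integral_add ((hC.integrable g).const_mul c) (hC.integrable h)]
  refine integral_congr_ae ?_
  filter_upwards [hC.coeFn_add (c • g) h, hC.coeFn_smul c g] with x h1 h2
  rw [h1, h2]

theorem integral_one (hC : PropertyC μ T F ι) : ∫ x, ι 1 x ∂μ = 1 := by
  have := hC.isProbabilityMeasure
  rw [integral_congr_ae hC.coeFn_one]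
  simp

theorem norm_integral_le (hC : PropertyC μ T F ι) (g : F) : ‖∫ x, ι g x ∂μ‖ ≤ ‖g‖ := by
  have := hC.isProbabilityMeasure
  simpa using norm_integral_le_of_norm_le_const (hC.ae_norm_le g)

/-- The transfer operator is the sum of the expectation and an operator with exponentially
decaying powers. -/
theorem exists_spectral_decomposition (hC : PropertyC μ T F ι) :
    ∃ (L N : F →L[ℂ] F) (C r : ℝ), (∀ g : F, IsTransferOf μ T (ι g) (ι (L g))) ∧
      0 < C ∧ 0 < r ∧ r < 1 ∧ (∀ k, ‖N ^ k‖ ≤ C * r ^ k) ∧ N 1 = 0 ∧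
      ∀ g, L g = (∫ x, ι g x ∂μ) • 1 + N g := by
  obtain ⟨L, hL, c, P, N, hLPN, hPP, hrank, hρ, hPN, hNP⟩ := hC.transfer
  have hPP' : ∀ g, P (P g) = P g := fun g => DFunLike.congr_fun hPP g
  have hPN' : ∀ g, P (N g) = 0 := fun g => DFunLike.congr_fun hPN g
  have hNP' : ∀ g, N (P g) = 0 := fun g => DFunLike.congr_fun hNP g
  have hL' : ∀ g, L g = c • P g + N g := fun g => by rw [hLPN]; rfl
  obtain ⟨⟨p, hp⟩, hp0, hspan⟩ := finrank_eq_one_iff'.1 hrank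
  have hp0' : p ≠ 0 := fun h => hp0 (Subtype.ext h)
  obtain ⟨q, hq⟩ := hp
  have hPp : P p = p := by rw [← hq]; exact hPP' q
  have hNp : N p = 0 := by rw [← hq]; exact hNP' q
  have hc1 : ‖c‖ ≤ 1 := hC.norm_le_one_of_eigenvector hL hp0' (by rw [hL', hPp, hNp, add_zero])
  have hρ1 : spectralRadius ℂ N < 1 := hρ.trans_le (by
    rw [← enorm_one (G := ℂ), enorm_le_iff_norm_le, norm_one]; exact hc1)
  obtain ⟨C, r, hC0, hr0, hr1, hN⟩ := exists_norm_pow_le_of_spectralRadius_lt_one hρ1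
  -- Since `N ^ k → 0`, `N` has no nonzero fixed vector. Hence `P 1 ≠ 0`, which forces `c = 1` and
  -- then `N 1 = 0`.
  have hfix : ∀ g, N g = g → g = 0 := by
    intro g hg
    have hk : ∀ k : ℕ, (N ^ k) g = g := fun k => by
      induction k with
      | zero => rfl
      | succ k ih => rw [pow_succ, mul_apply_eq_comp, hg, ih]
    have hle : ∀ k : ℕ, ‖g‖ ≤ C * r ^ k * ‖g‖ := fun k => by
      conv_lhs => rw [← hk k]
      exact ((N ^ k).le_opNorm g).trans (mul_le_mul_of_nonneg_right (hN k) (norm_nonneg _))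
    have hlim : Tendsto (fun k : ℕ => C * r ^ k * ‖g‖) atTop (𝓝 (C * 0 * ‖g‖)) :=
      ((tendsto_pow_atTop_nhds_zero_of_lt_one hr0.le hr1).const_mul C).mul_const _
    have := ge_of_tendsto' hlim hle
    simpa using this
  have h1 : L 1 = 1 := hC.transfer_one hL
  have hcP : c • P 1 = P 1 := by
    have : P (L 1) = c • P 1 := by rw [hL', map_add, map_smul, hPP', hPN', add_zero]
    rw [← this, h1]
  have hP1 : P 1 ≠ 0 := by
    intro h
    refine hC.one_ne_zero (hfix 1 ?_)
    have := hL' 1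
    rw [h, smul_zero, zero_add, h1] at this
    exact this.symm
  have hc : c = 1 := by
    have : (c - 1) • P 1 = 0 := by rw [sub_smul, hcP, one_smul, sub_self]
    rcases smul_eq_zero.1 this with h | h
    · exact sub_eq_zero.1 h
    · exact absurd h hP1
  have hN1 : N 1 = 0 := by
    have h2 : (1 : F) = P 1 + N 1 := by
      have := hL' 1
      rwa [h1, hc, one_smul] at this
    refine hfix _ ?_
    have := congrArg N h2
    rw [map_add, hNP', zero_add] at this
    exact this.symm
  have hP1' : P 1 = 1 := by
    have := hL' 1
    rw [h1, hc, one_smul, hN1, add_zero] at this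
    exact this.symm
  obtain ⟨s, hs⟩ := hspan ⟨1, 1, hP1'⟩
  have hs' : s • p = 1 := congrArg Subtype.val hs
  have hs0 : s ≠ 0 := by rintro rfl; exact hC.one_ne_zero (by rw [← hs', zero_smul])
  have hPrange : ∀ g, ∃ a : ℂ, P g = a • 1 := by
    intro g
    obtain ⟨b, hb⟩ := hspan ⟨P g, g, rfl⟩
    have hb' : b • p = P g := congrArg Subtype.val hb
    exact ⟨b * s⁻¹, by rw [← hs', smul_smul, mul_assoc, inv_mul_cancel₀ hs0, mul_one, hb']⟩
  -- `L` preserves integrals and `P N = 0`, so the decomposition can be iterated on the `N` part; as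
  -- `k → ∞` that part vanishes and identifies `P g` as the mean of `g`.
  have hint : ∀ g k, ∫ x, ι g x ∂μ = ∫ x, ι (P g) x ∂μ + ∫ x, ι ((N ^ k) (N g)) x ∂μ := by
    intro g k
    have hstep : ∀ h, ∫ x, ι h x ∂μ = ∫ x, ι (P h) x ∂μ + ∫ x, ι (N h) x ∂μ := fun h => by
      rw [← hC.integral_transfer hL h, hL', hc, hC.integral_add_smul, one_mul]
    induction k with
    | zero => exact hstep g
    | succ k ih =>
      rw [ih, hstep ((N ^ k) (N g))]
      have hz : P ((N ^ k) (N g)) = 0 := by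
        rw [← mul_apply_eq_comp (N ^ k), ← pow_succ, pow_succ', mul_apply_eq_comp, hPN']
      rw [hz, pow_succ', mul_apply_eq_comp, map_zero]
      rw [integral_congr_ae AEEqFun.coeFn_zero]
      simp
  have hPint : ∀ g, P g = (∫ x, ι g x ∂μ) • 1 := by
    intro g
    obtain ⟨a, ha⟩ := hPrange g
    have ha1 : ∫ x, ι (P g) x ∂μ = a := by
      have := hC.integral_add_smul a 1 0
      rw [hC.integral_one, add_zero, ← ha, map_zero, integral_congr_ae AEEqFun.coeFn_zero] at this
      simpa using this
    have hle : ∀ k : ℕ, ‖(∫ x, ι g x ∂μ) - a‖ ≤ C * r ^ k * ‖N g‖ := fun k => by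
      rw [hint g k, ha1, add_sub_cancel_left]
      exact (hC.norm_integral_le _).trans (((N ^ k).le_opNorm _).trans
        (mul_le_mul_of_nonneg_right (hN k) (norm_nonneg _)))
    have hlim : Tendsto (fun k : ℕ => C * r ^ k * ‖N g‖) atTop (𝓝 (C * 0 * ‖N g‖)) :=
      ((tendsto_pow_atTop_nhds_zero_of_lt_one hr0.le hr1).const_mul C).mul_const _
    have := ge_of_tendsto' hlim hle
    rw [mul_zero, zero_mul, norm_le_zero_iff, sub_eq_zero] at this
    rw [this, ha]
  exact ⟨L, N, C, r, hL, hC0, hr0, hr1, hN, hN1, fun g => by rw [hL', hc, one_smul, hPint]⟩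

end PropertyC

end SpectralGap

/-! ### Exponential moments through the perturbed transfer operator. -/

section ExponentialMoments

/-- Termwise comparison with the series of `e^{‖x‖} - 1`. Dropping the term of order zero matters,
since `‖1‖ = 1` is not assumed. -/
theorem norm_exp_sub_one_le_two_mul {A : Type*} [NormedRing A] [NormedAlgebra ℂ A]
    [CompleteSpace A] {x : A} (hx : ‖x‖ ≤ 1) : ‖NormedSpace.exp x - 1‖ ≤ 2 * ‖x‖ := by
  have h1 : HasSum (fun n : ℕ => ((n.factorial : ℂ))⁻¹ • x ^ n) (NormedSpace.exp x) :=
    NormedSpace.exp_series_hasSum_exp' x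
  have h2 : HasSum (fun n : ℕ => ((n.factorial : ℝ))⁻¹ • ‖x‖ ^ n) (NormedSpace.exp ‖x‖) :=
    NormedSpace.exp_series_hasSum_exp' ‖x‖
  rw [← Real.exp_eq_exp_ℝ] at h2
  have h1' := (hasSum_nat_add_iff' 1).2 h1
  have h2' := (hasSum_nat_add_iff' 1).2 h2
  have h3 := h1'.norm_le_of_bounded h2' fun n => by
    rw [norm_smul, norm_inv, Complex.norm_natCast, smul_eq_mul]
    exact mul_le_mul_of_nonneg_left (norm_pow_le' x n.succ_pos) (by positivity)
  simp only [Finset.range_one, Finset.sum_singleton, Nat.factorial_zero, Nat.cast_one, inv_one,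
    pow_zero, one_smul] at h3
  have h4 := Real.abs_exp_sub_one_le (x := ‖x‖) (by rwa [abs_of_nonneg (norm_nonneg x)])
  rw [abs_of_nonneg (norm_nonneg x)] at h4
  exact h3.trans ((le_abs_self _).trans h4)

theorem ae_abs_birkhoffSum_le {Ω : Type*} [MeasurableSpace Ω] {μ : Measure Ω} {T : Ω → Ω}
    (hT : MeasurePreserving T μ μ) {f : Ω → ℝ} {b : ℝ} (hb : ∀ᵐ x ∂μ, |f x| ≤ b) (n : ℕ) :
    ∀ᵐ x ∂μ, |birkhoffSum T f n x| ≤ n * b := by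
  have h : ∀ᵐ x ∂μ, ∀ k, |f (T^[k] x)| ≤ b :=
    ae_all_iff.2 fun k => (hT.iterate k).quasiMeasurePreserving.ae hb
  filter_upwards [h] with x hx
  refine (Finset.abs_sum_le_sum_abs _ _).trans ((Finset.sum_le_sum fun i _ => hx i).trans ?_)
  simp

namespace PropertyC

variable {Ω : Type*} [MeasurableSpace Ω] {μ : Measure Ω} {T : Ω → Ω}
  {F : Type*} [NormedRing F] [NormedAlgebra ℂ F] [CompleteSpace F] {ι : F →ₗ[ℂ] (Ω →ₘ[μ] ℂ)}

theorem coeFn_pow (hC : PropertyC μ T F ι) (g : F) (k : ℕ) :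
    ∀ᵐ x ∂μ, ι (g ^ k) x = ι g x ^ k := by
  induction k with
  | zero => simpa using hC.coeFn_one
  | succ k ih =>
    filter_upwards [ih, hC.coeFn_mul (g ^ k) g] with x h1 h2
    rw [pow_succ, h2, h1, pow_succ]

/-- The norm of `F` dominates the essential supremum, so the partial sums of the exponential series
also converge almost everywhere. -/
theorem coeFn_exp (hC : PropertyC μ T F ι) (g : F) :
    ∀ᵐ x ∂μ, ι (NormedSpace.exp g) x = Complex.exp (ι g x) := by
  set s : ℕ → F := fun m => ∑ k ∈ Finset.range m, ((k.factorial : ℂ))⁻¹ • g ^ k with hs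
  have hlim : Tendsto s atTop (𝓝 (NormedSpace.exp g)) :=
    (NormedSpace.exp_series_hasSum_exp' (𝕂 := ℂ) g).tendsto_sum_nat
  have hsm : ∀ m, ∀ᵐ x ∂μ, ι (s m) x =
      ∑ k ∈ Finset.range m, ((k.factorial : ℂ))⁻¹ • ι g x ^ k := by
    intro m
    induction m with
    | zero =>
      simp only [hs, Finset.range_zero, Finset.sum_empty, map_zero]
      exact AEEqFun.coeFn_zero
    | succ m ih =>
      filter_upwards [ih, hC.coeFn_add (s m) (((m.factorial : ℂ))⁻¹ • g ^ m),
        hC.coeFn_smul ((m.factorial : ℂ))⁻¹ (g ^ m), hC.coeFn_pow g m] with x h1 h2 h3 h4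
      have : s (m + 1) = s m + ((m.factorial : ℂ))⁻¹ • g ^ m := Finset.sum_range_succ _ _
      rw [this, h2, h1, h3, h4, Finset.sum_range_succ, smul_eq_mul]
  have hbd : ∀ m, ∀ᵐ x ∂μ, ‖ι (s m) x - ι (NormedSpace.exp g) x‖ ≤ ‖s m - NormedSpace.exp g‖ := by
    intro m
    filter_upwards [hC.ae_norm_le (s m - NormedSpace.exp g),
      hC.coeFn_sub (s m) (NormedSpace.exp g)] with x h1 h2
    rwa [← h2]
  filter_upwards [ae_all_iff.2 hsm, ae_all_iff.2 hbd] with x h1 h2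
  have l1 : Tendsto (fun m => ι (s m) x) atTop (𝓝 (ι (NormedSpace.exp g) x)) := by
    rw [tendsto_iff_norm_sub_tendsto_zero]
    exact squeeze_zero (fun _ => norm_nonneg _) h2 (tendsto_iff_norm_sub_tendsto_zero.1 hlim)
  have l2 : Tendsto (fun m => ι (s m) x) atTop (𝓝 (Complex.exp (ι g x))) := by
    simp only [h1]
    rw [Complex.exp_eq_exp_ℂ]
    exact (NormedSpace.exp_series_hasSum_exp' (𝕂 := ℂ) (ι g x)).tendsto_sum_nat
  exact tendsto_nhds_unique l1 l2

/-- Iterating the operator `v ↦ T̂ (e^{f} v)` gives the exponentials of the Birkhoff sums. -/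
theorem integral_iterate_transfer_mul (hC : PropertyC μ T F ι) {L : F →L[ℂ] F}
    (hL : ∀ g : F, IsTransferOf μ T (ι g) (ι (L g))) {e : F} {f : Ω → ℝ}
    (he : ∀ᵐ x ∂μ, ι e x = (Real.exp (f x) : ℂ)) (n : ℕ) (g : Ω → ℂ) (hg : MemLp g ∞ μ) :
    ∫ x, ι ((fun v => L (e * v))^[n] 1) x * g x ∂μ =
      ∫ x, (Real.exp (birkhoffSum T f n x) : ℂ) * g (T^[n] x) ∂μ := by
  have hT := hC.measurePreserving
  induction n generalizing g with
  | zero =>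
    refine integral_congr_ae ?_
    filter_upwards [hC.coeFn_one] with x hx
    simp [hx]
  | succ n ih =>
    have hg' : MemLp (fun x => ι e x * g (T x)) ∞ μ :=
      (hg.comp_measurePreserving hT).mul (hC.memLp_top e)
    rw [Function.iterate_succ_apply', (hL _).2.2 g hg]
    refine Eq.trans ?_ ((ih _ hg').trans ?_)
    · refine integral_congr_ae ?_
      filter_upwards [hC.coeFn_mul e ((fun v => L (e * v))^[n] 1)] with x hx
      rw [hx]; ring
    · refine integral_congr_ae ?_
      filter_upwards [(hT.iterate n).quasiMeasurePreserving.ae he] with x hx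
      simp only [hx, birkhoffSum_succ, Real.exp_add, Complex.ofReal_mul, mul_assoc,
        Function.iterate_succ_apply']

/-- Exponential moments of Birkhoff sums: `∫ exp (t S_n f) ≤ exp (D n t² ‖φ‖ |f|₁)` if
`|t| ‖φ‖` is small. -/
theorem exists_integral_exp_birkhoffSum_le (hC : PropertyC μ T F ι) :
    ∃ δ D : ℝ, 0 < δ ∧ 0 < D ∧ ∀ (φ : F) (f : Ω → ℝ), Measurable f →
      (∀ᵐ x ∂μ, ι φ x = (f x : ℂ)) → ∫ x, f x ∂μ = 0 → ∀ (t : ℝ), |t| * ‖φ‖ ≤ δ → ∀ n : ℕ,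
        ∫ x, Real.exp (t * birkhoffSum T f n x) ∂μ ≤
          Real.exp (n * (D * t ^ 2 * ‖φ‖ * ∫ x, |f x| ∂μ)) := by
  have hprob := hC.isProbabilityMeasure
  have hT := hC.measurePreserving
  obtain ⟨L, N, C, r, hL, hC0, hr0, hr1, hN, hN1, hLN⟩ := hC.exists_spectral_decomposition
  have h1pos : 0 < ‖(1 : F)‖ := norm_pos_iff.2 hC.one_ne_zero
  -- `κ`, `B` and the bound `δ` on `s` are tuned for `hbr`: `r = 1 - 4κ`, while `C ‖1‖` and `C * 2s
  -- * B` are each at most `κ B`, leaving room for the loss `1 - κ` of `hlow`.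
  set κ := (1 - r) / 4 with hκ
  have hκ0 : 0 < κ := by rw [hκ]; linarith
  have hκ1 : κ < 1 := by rw [hκ]; linarith
  set B := C * ‖(1 : F)‖ / κ with hB
  have hB0 : 0 < B := by positivity
  have hBκ : C * ‖(1 : F)‖ = κ * B := by rw [hB]; field_simp
  refine ⟨min κ (κ / (2 * C)), 1 + 4 * B, lt_min hκ0 (by positivity), by positivity, ?_⟩
  intro φ f hf hφf hf0 t ht
  set s := |t| * ‖φ‖ with hs
  have hs0 : 0 ≤ s := by positivity
  have hsκ : s ≤ κ := ht.trans (min_le_left _ _)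
  have hsC : C * (2 * s) ≤ κ := by
    have := ht.trans (min_le_right _ _)
    rw [le_div_iff₀ (by positivity)] at this
    linarith
  have hs1 : s ≤ 1 := hsκ.trans hκ1.le
  have hfb : ∀ᵐ x ∂μ, |f x| ≤ ‖φ‖ := by
    filter_upwards [hφf, hC.ae_norm_le φ] with x h1 h2
    rwa [h1, Complex.norm_real] at h2
  have htf : ∀ᵐ x ∂μ, |t * f x| ≤ s := by
    filter_upwards [hfb] with x hx
    rw [abs_mul]
    exact mul_le_mul_of_nonneg_left hx (abs_nonneg _)
  have hfi : Integrable f μ := Integrable.of_bound hf.aestronglyMeasurable _ hfb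
  set I := ∫ x, |f x| ∂μ with hI
  have hI0 : 0 ≤ I := integral_nonneg fun x => abs_nonneg _
  have hSm := measurable_birkhoffSum hT.measurable hf
  have hSb : ∀ n, ∀ᵐ x ∂μ, |t * birkhoffSum T f n x| ≤ |t| * (n * ‖φ‖) := fun n => by
    filter_upwards [ae_abs_birkhoffSum_le hT hfb n] with x hx
    rw [abs_mul]
    exact mul_le_mul_of_nonneg_left hx (abs_nonneg _)
  have hexpi : ∀ n, Integrable (fun x => Real.exp (t * birkhoffSum T f n x)) μ := fun n => by
    refine Integrable.of_bound (Real.measurable_exp.comp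
      ((hSm n).const_mul t)).aestronglyMeasurable (Real.exp (|t| * (n * ‖φ‖))) ?_
    filter_upwards [hSb n] with x hx
    rw [Real.norm_of_nonneg (Real.exp_pos _).le]
    exact Real.exp_le_exp.2 ((le_abs_self _).trans hx)
  set a : ℕ → ℝ := fun n => ∫ x, Real.exp (t * birkhoffSum T f n x) ∂μ with ha
  have ha0 : ∀ n, 0 ≤ a n := fun n => integral_nonneg fun x => (Real.exp_pos _).le
  -- Converts bounds in terms of `a n` into bounds in terms of `a (n + 1)` in the induction for
  -- `hclaim`.
  have hlow : ∀ n, a n * (1 - κ) ≤ a (n + 1) := by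
    intro n
    have : a n * Real.exp (-s) ≤ a (n + 1) := by
      rw [ha, ← integral_mul_const]
      refine integral_mono_ae ((hexpi n).mul_const _) (hexpi (n + 1)) ?_
      filter_upwards [(hT.iterate n).quasiMeasurePreserving.ae htf] with x hx
      rw [← Real.exp_add, birkhoffSum_succ, mul_add]
      exact Real.exp_le_exp.2 (add_le_add le_rfl (neg_le_of_abs_le hx))
    refine le_trans (mul_le_mul_of_nonneg_left ?_ (ha0 n)) this
    have := Real.add_one_le_exp (-s)
    linarith
  -- the perturbed transfer operator
  set e : F := NormedSpace.exp ((t : ℂ) • φ) with he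
  have hnorm : ‖(t : ℂ) • φ‖ = s := by rw [norm_smul, Complex.norm_real, Real.norm_eq_abs]
  have he1 : ‖e - 1‖ ≤ 2 * s := by
    have := norm_exp_sub_one_le_two_mul (x := (t : ℂ) • φ) (by rwa [hnorm])
    rwa [hnorm] at this
  have hιe : ∀ᵐ x ∂μ, ι e x = (Real.exp (t * f x) : ℂ) := by
    filter_upwards [hC.coeFn_exp ((t : ℂ) • φ), hC.coeFn_smul t φ, hφf] with x h1 h2 h3
    rw [h1, h2, h3]; simp
  set v : ℕ → F := fun n => (fun v => L (e * v))^[n] 1 with hv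
  have hv0 : v 0 = 1 := rfl
  have hvs : ∀ n, v (n + 1) = L (e * v n) := fun n => Function.iterate_succ_apply' _ _ _
  have hbirk : ∀ n x, birkhoffSum T (fun x => t * f x) n x = t * birkhoffSum T f n x :=
    fun n x => by simp [birkhoffSum, Finset.mul_sum]
  have hva : ∀ n, ∫ x, ι (v n) x ∂μ = (a n : ℂ) := fun n => by
    have := hC.integral_iterate_transfer_mul hL hιe n (fun _ => 1) (memLp_top_const _)
    simp only [mul_one, hbirk] at this
    rw [integral_complex_ofReal] at this
    exact this
  set w : ℕ → F := fun n => v n - (a n : ℂ) • 1 with hw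
  have hvw : ∀ n, v n = (a n : ℂ) • 1 + w n := fun n => by simp [hw]
  have hw0 : w 0 = 0 := by simp [hw, hv0, ha]
  have hevint : ∀ n, ∫ x, ι (e * v n) x ∂μ = (a (n + 1) : ℂ) := fun n => by
    rw [← hC.integral_transfer hL, ← hvs, hva]
  have hws : ∀ n, w (n + 1) = N (w n) + N ((e - 1) * v n) := fun n => by
    have h1 : e * v n = (e - 1) * v n + ((a n : ℂ) • 1 + w n) := by
      rw [← hvw]; noncomm_ring
    have h2 : w (n + 1) = N (e * v n) := by
      simp only [hw]
      rw [hvs, hLN, hevint, add_sub_cancel_left]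
    rw [h2, h1, map_add, map_add, map_smul, hN1, smul_zero, zero_add, add_comm]
  -- `‖N‖` itself may exceed `1`, so all `N ^ k` are controlled at once with weight `r ^ k`, as an
  -- adapted norm would do.
  have hclaim : ∀ n k, ‖(N ^ k) (w n)‖ ≤ B * (2 * s) * a n * r ^ k := by
    intro n
    induction n with
    | zero =>
      intro k
      rw [hw0, map_zero, norm_zero]
      have := ha0 0
      positivity
    | succ n ih =>
      intro k
      have hk : (N ^ k) (w (n + 1)) = (N ^ (k + 1)) (w n) + (N ^ (k + 1)) ((e - 1) * v n) := by
        rw [hws, map_add, pow_succ]; rfl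
      have hwn : ‖w n‖ ≤ B * (2 * s) * a n := by simpa using ih 0
      have hvn : ‖v n‖ ≤ a n * (‖(1 : F)‖ + B * (2 * s)) := by
        rw [hvw]
        refine (norm_add_le _ _).trans ?_
        rw [norm_smul, Complex.norm_real, Real.norm_of_nonneg (ha0 n)]
        linarith
      have h2 : ‖(N ^ (k + 1)) ((e - 1) * v n)‖ ≤
          C * r ^ (k + 1) * (2 * s * (a n * (‖(1 : F)‖ + B * (2 * s)))) := by
        refine ((N ^ (k + 1)).le_opNorm _).trans (mul_le_mul (hN _) ?_ (norm_nonneg _)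
          (by positivity))
        exact (norm_mul_le _ _).trans (mul_le_mul he1 hvn (norm_nonneg _) (by positivity))
      have hrk : 0 < r ^ k := by positivity
      have hbr : r * (B + C * (‖(1 : F)‖ + B * (2 * s))) ≤ B * (1 - κ) := by
        have e1 : C * (‖(1 : F)‖ + B * (2 * s)) ≤ 2 * κ * B := by
          have := mul_le_mul_of_nonneg_left hsC hB0.le
          linarith
        have e2 : r * (C * (‖(1 : F)‖ + B * (2 * s))) ≤ 2 * κ * B :=
          (mul_le_of_le_one_left (by positivity) hr1.le).trans e1
        have e3 : r = 1 - 4 * κ := by rw [hκ]; ring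
        have e4 : r * B = (1 - 4 * κ) * B := by rw [← e3]
        have e5 : 0 < κ * B := by positivity
        linarith
      calc ‖(N ^ k) (w (n + 1))‖
          ≤ B * (2 * s) * a n * r ^ (k + 1) +
            C * r ^ (k + 1) * (2 * s * (a n * (‖(1 : F)‖ + B * (2 * s)))) := by
            rw [hk]
            exact (norm_add_le _ _).trans (add_le_add (ih _) h2)
        _ = (2 * s * r ^ k * a n) * (r * (B + C * (‖(1 : F)‖ + B * (2 * s)))) := by ring
        _ ≤ (2 * s * r ^ k * a n) * (B * (1 - κ)) :=
            mul_le_mul_of_nonneg_left hbr (by have := ha0 n; positivity)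
        _ = (2 * s * r ^ k * B) * (a n * (1 - κ)) := by ring
        _ ≤ (2 * s * r ^ k * B) * a (n + 1) :=
            mul_le_mul_of_nonneg_left (hlow n) (by positivity)
        _ = _ := by ring
  -- The linear term has mean zero; in the quadratic one, one factor `|f|` is bounded by `‖φ‖` and
  -- the other integrated.
  have hone : ∫ x, Real.exp (t * f x) ∂μ ≤ 1 + t ^ 2 * ‖φ‖ * I := by
    have hi1 : Integrable (fun x => 1 + t * f x) μ := (integrable_const 1).add (hfi.const_mul t)
    have hi2 : Integrable (fun x => 1 + t * f x + t ^ 2 * ‖φ‖ * |f x|) μ :=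
      hi1.add (hfi.abs.const_mul _)
    have hval : ∫ x, (1 + t * f x + t ^ 2 * ‖φ‖ * |f x|) ∂μ = 1 + t ^ 2 * ‖φ‖ * I := by
      rw [integral_add hi1 (hfi.abs.const_mul _),
        integral_add (integrable_const 1) (hfi.const_mul t), integral_const_mul,
        integral_const_mul, hf0, ← hI]
      simp
    rw [← hval]
    refine integral_mono_ae (by simpa [birkhoffSum_one] using hexpi 1) hi2 ?_
    filter_upwards [htf, hfb] with x h1 h2
    have h3 := (le_abs_self _).trans (Real.abs_exp_sub_one_sub_id_le (h1.trans hs1))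
    have h4 : (t * f x) ^ 2 ≤ t ^ 2 * ‖φ‖ * |f x| := by
      rw [mul_pow, ← sq_abs (f x), sq |f x|, mul_assoc]
      exact mul_le_mul_of_nonneg_left (mul_le_mul_of_nonneg_right h2 (abs_nonneg _)) (sq_nonneg _)
    linarith
  -- Because `w n` has mean zero, `e` may be replaced by `e - 1`, of `L¹` norm at most `2 |t| I`.
  -- The rate `1 + 4B` is `1` from `hone` plus `2 * 2B` from this term.
  have hstep : ∀ n, a (n + 1) ≤ a n * (1 + (1 + 4 * B) * t ^ 2 * ‖φ‖ * I) := by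
    intro n
    have hwn : ‖w n‖ ≤ B * (2 * s) * a n := by simpa using hclaim n 0
    have hwint : ∫ x, ι (w n) x ∂μ = 0 := by
      have := hC.integral_add_smul (a n) 1 (w n)
      rw [← hvw, hva, hC.integral_one] at this
      simpa using this
    have hmul : Integrable (fun x => (ι e x - 1) * ι (w n) x) μ := by
      refine ((hC.integrable (e * w n)).sub (hC.integrable (w n))).congr ?_
      filter_upwards [hC.coeFn_mul e (w n)] with x hx
      simp only [Pi.sub_apply, hx]; ring
    have hsum : Integrable (fun x => a n * ι e x + (ι e x - 1) * ι (w n) x) μ :=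
      ((hC.integrable e).const_mul _).add hmul
    have hdec : (a (n + 1) : ℂ) = a n * ∫ x, ι e x ∂μ + ∫ x, (ι e x - 1) * ι (w n) x ∂μ := by
      rw [← hevint]
      have : ∫ x, ι (e * v n) x ∂μ =
          ∫ x, (a n * ι e x + (ι e x - 1) * ι (w n) x + ι (w n) x) ∂μ := by
        refine integral_congr_ae ?_
        filter_upwards [hC.coeFn_mul e (v n), hC.coeFn_add ((a n : ℂ) • 1) (w n),
          hC.coeFn_smul (a n) 1, hC.coeFn_one] with x h1 h2 h3 h4
        rw [h1, hvw, h2, h3, h4]; ring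
      rw [this, integral_add hsum (hC.integrable _),
        integral_add ((hC.integrable e).const_mul _) hmul, integral_const_mul, hwint, add_zero]
    have he' : ∫ x, ι e x ∂μ = ((∫ x, Real.exp (t * f x) ∂μ : ℝ) : ℂ) := by
      rw [integral_congr_ae hιe, integral_complex_ofReal]
    have hrest : ‖∫ x, (ι e x - 1) * ι (w n) x ∂μ‖ ≤ 2 * |t| * I * (B * (2 * s) * a n) := by
      refine (norm_integral_le_integral_norm _).trans ?_
      have : 2 * |t| * I * (B * (2 * s) * a n) =
          ∫ x, 2 * |t| * (B * (2 * s) * a n) * |f x| ∂μ := by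
        rw [integral_const_mul]; ring
      rw [this]
      refine integral_mono_ae hmul.norm (hfi.abs.const_mul _) ?_
      filter_upwards [hιe, htf, hC.ae_norm_le (w n)] with x h1 h2 h3
      have h4 : ‖ι e x - 1‖ ≤ 2 * (|t| * |f x|) := by
        rw [h1, ← abs_mul]
        have := Real.abs_exp_sub_one_le (h2.trans hs1)
        rwa [← Real.norm_eq_abs, ← Complex.norm_real, Complex.ofReal_sub, Complex.ofReal_one]
          at this
      rw [norm_mul]
      refine (mul_le_mul h4 (h3.trans hwn) (norm_nonneg _) (by positivity)).trans (le_of_eq ?_)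
      ring
    have hnormeq : a (n + 1) = ‖(a (n + 1) : ℂ)‖ := by
      rw [Complex.norm_real, Real.norm_of_nonneg (ha0 _)]
    rw [hnormeq, hdec]
    refine (norm_add_le _ _).trans ?_
    have hm0 : 0 ≤ ∫ x, Real.exp (t * f x) ∂μ := integral_nonneg fun x => (Real.exp_pos _).le
    rw [he', norm_mul, Complex.norm_real, Complex.norm_real, Real.norm_of_nonneg (ha0 _),
      Real.norm_of_nonneg hm0]
    have h5 := mul_le_mul_of_nonneg_left hone (ha0 n)
    have h6 : 2 * |t| * I * (B * (2 * s) * a n) = a n * (4 * B * t ^ 2 * ‖φ‖ * I) := by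
      rw [hs, ← sq_abs t]; ring
    rw [h6] at hrest
    refine (add_le_add h5 hrest).trans (le_of_eq ?_)
    ring
  intro n
  change a n ≤ _
  induction n with
  | zero => simp [ha]
  | succ n ih =>
    set X := (1 + 4 * B) * t ^ 2 * ‖φ‖ * I with hX
    have hX0 : 0 ≤ X := by positivity
    calc a (n + 1) ≤ a n * (1 + X) := hstep n
      _ ≤ Real.exp (n * X) * Real.exp X :=
        mul_le_mul ih (by rw [add_comm]; exact Real.add_one_le_exp X) (by positivity)
          (Real.exp_pos _).le
      _ = Real.exp ((n + 1 : ℕ) * X) := by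
        rw [← Real.exp_add]; congr 1; push_cast; ring

end PropertyC

end ExponentialMoments

/-! ### Coboundary equation, choice of `t` and the final bound. -/

section DeviationInequality

theorem div_mul_le_self_of_nonneg {a : ℝ} (ha : 0 ≤ a) (b : ℝ) : a / b * b ≤ a := by
  rcases eq_or_ne b 0 with rfl | hb
  · simpa using ha
  · rw [div_mul_cancel₀ a hb]

namespace PropertyC

variable {Ω : Type*} [MeasurableSpace Ω] {μ : Measure Ω} {T : Ω → Ω}
  {F : Type*} [NormedRing F] [NormedAlgebra ℂ F] [CompleteSpace F] {ι : F →ₗ[ℂ] (Ω →ₘ[μ] ℂ)}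

/-- The real part of an element of `F` has a measurable version that is bounded everywhere. -/
theorem exists_bounded_version_re (hC : PropertyC μ T F ι) (g : F) :
    ∃ G : Ω → ℝ, Measurable G ∧ (∀ x, |G x| ≤ ‖g‖) ∧ ∀ᵐ x ∂μ, G x = (ι g x).re := by
  refine ⟨fun x => max (-‖g‖) (min ‖g‖ (ι g x).re), ?_, fun x => ?_, ?_⟩
  · exact measurable_const.max (measurable_const.min
      (Complex.measurable_re.comp (ι g).stronglyMeasurable.measurable))
  · exact abs_le.2 ⟨le_max_left _ _,
      max_le (neg_le_self (norm_nonneg g)) (min_le_left _ _)⟩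
  · filter_upwards [hC.ae_norm_le g] with x hx
    have := abs_le.1 ((Complex.abs_re_le_norm _).trans hx)
    rw [min_eq_right this.2, max_eq_right this.1]

/-- Elements of mean zero are coboundaries for the transfer operator. -/
theorem exists_sub_transfer_eq (hC : PropertyC μ T F ι) :
    ∃ (L : F →L[ℂ] F) (M : ℝ), (∀ g : F, IsTransferOf μ T (ι g) (ι (L g))) ∧ 0 ≤ M ∧
      ∀ φ : F, ∫ x, ι φ x ∂μ = 0 → ∃ g : F, φ = g - L g ∧ ‖L g‖ ≤ M * ‖φ‖ := by
  obtain ⟨L, N, C, r, hL, hC0, hr0, hr1, hN, -, hLN⟩ := hC.exists_spectral_decomposition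
  have hr : 0 < 1 - r := by linarith
  refine ⟨L, ‖L‖ * (C * (1 - r)⁻¹), hL, by positivity, fun φ hφ => ?_⟩
  have hterm : ∀ k, ‖(N ^ k) φ‖ ≤ C * ‖φ‖ * r ^ k := fun k =>
    ((N ^ k).le_opNorm φ).trans ((mul_le_mul_of_nonneg_right (hN k) (norm_nonneg _)).trans
      (le_of_eq (by ring)))
  have hgeom : HasSum (fun k => C * ‖φ‖ * r ^ k) (C * ‖φ‖ * (1 - r)⁻¹) :=
    (hasSum_geometric_of_lt_one hr0.le hr1).mul_left _
  have hsum : Summable fun k => (N ^ k) φ := Summable.of_norm_bounded hgeom.summable hterm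
  -- Neumann series for `(1 - N)⁻¹ φ`. It has mean zero, so `L g = N g`.
  set g := ∑' k, (N ^ k) φ with hg
  have hNg : g = φ + N g := by
    rw [hg, N.map_tsum hsum]
    conv_lhs => rw [hsum.tsum_eq_zero_add]
    simp only [pow_succ', mul_apply_eq_comp, pow_zero, one_apply_eq_self]
  have hmean : ∀ h, ∫ x, ι (N h) x ∂μ = 0 := fun h => by
    have := hC.integral_transfer hL h
    rw [hLN, hC.integral_add_smul, hC.integral_one] at this
    simpa using this
  have hgmean : ∫ x, ι g x ∂μ = 0 := by
    have := hC.integral_add_smul 1 φ (N g)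
    rwa [one_smul, ← hNg, hφ, hmean, mul_zero, add_zero] at this
  refine ⟨g, ?_, ?_⟩
  · rw [hLN, hgmean, zero_smul, zero_add, eq_sub_iff_add_eq]
    exact hNg.symm
  · refine (L.le_opNorm g).trans ?_
    rw [mul_assoc]
    refine mul_le_mul_of_nonneg_left ((tsum_of_norm_bounded hgeom hterm).trans (le_of_eq ?_))
      (norm_nonneg _)
    ring

/-- Joins the coboundary equation, the maximal inequality and the moment bounds at `t` and `-t`,
leaving `t` free. The work is in passing from classes to everywhere bounded real versions `G` and
`H`. -/
theorem exists_maximal_exponential_bound (hC : PropertyC μ T F ι) :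
    ∃ δ D M : ℝ, 0 < δ ∧ 0 < D ∧ 0 ≤ M ∧ ∀ (φ : F) (f : Ω → ℝ), (∀ᵐ x ∂μ, ι φ x = (f x : ℂ)) →
      ∫ x, f x ∂μ = 0 → ∀ u t : ℝ, 0 ≤ t → t * ‖φ‖ ≤ δ → ∀ n : ℕ,
        μ.real {x | u ≤ (Finset.range (n + 1)).sup' Finset.nonempty_range_add_one
            (fun i => |birkhoffSum T f i x|)} ≤
          Real.exp (4 * t * (M * ‖φ‖) - t * u / 2) *
            (2 * Real.exp (n * (D * t ^ 2 * ‖φ‖ * ∫ x, |f x| ∂μ))) := by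
  have := hC.isProbabilityMeasure
  have hT := hC.measurePreserving
  obtain ⟨δ, D, hδ, hD, hexp⟩ := hC.exists_integral_exp_birkhoffSum_le
  obtain ⟨L, M, hL, hM, hcob⟩ := hC.exists_sub_transfer_eq
  refine ⟨δ, D, M, hδ, hD, hM, fun φ f hφf hf0 u t ht htφ n => ?_⟩
  have hφ0 : ∫ x, ι φ x ∂μ = 0 := by
    rw [integral_congr_ae hφf, integral_complex_ofReal, hf0, Complex.ofReal_zero]
  obtain ⟨g, hg, hLg⟩ := hcob φ hφ0
  obtain ⟨G, hGm, hGb, hGe⟩ := hC.exists_bounded_version_re g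
  obtain ⟨H, hHm, hHb, hHe⟩ := hC.exists_bounded_version_re (L g)
  have hff : ∀ᵐ x ∂μ, f x = G x - H x := by
    filter_upwards [hφf, hGe, hHe, hC.coeFn_sub g (L g)] with x h1 h2 h3 h4
    rw [h2, h3, ← Complex.sub_re, ← h4, ← hg, h1, Complex.ofReal_re]
  have hmart : ∀ W : Ω → ℝ, Measurable W → (∃ c, ∀ x, |W x| ≤ c) →
      ∫ x, G x * W (T x) ∂μ = ∫ x, H x * W x ∂μ := by
    rintro W hW ⟨c, hc⟩
    have hWp : MemLp (fun x => (W x : ℂ)) ∞ μ :=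
      memLp_top_of_bound (Complex.measurable_ofReal.comp hW).aestronglyMeasurable c
        (ae_of_all _ fun x => by rw [Complex.norm_real]; exact hc x)
    have hre : ∀ (h : F) (Y V : Ω → ℝ), (∀ᵐ x ∂μ, Y x = (ι h x).re) → Measurable V →
        (∀ x, |V x| ≤ c) → ∫ x, Y x * V x ∂μ = (∫ x, ι h x * V x ∂μ).re := by
      intro h Y V hY hV hVc
      have hi : Integrable (fun x => ι h x * (V x : ℂ)) μ :=
        (hC.integrable h).mul_bdd (Complex.measurable_ofReal.comp hV).aestronglyMeasurable
          (ae_of_all _ fun x => by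
            change ‖((V x : ℝ) : ℂ)‖ ≤ c
            rw [Complex.norm_real]; exact hVc x)
      refine Eq.trans (integral_congr_ae ?_) (integral_re hi)
      filter_upwards [hY] with x hx
      simp [hx]
    rw [hre g G (fun x => W (T x)) hGe (hW.comp hT.measurable) fun x => hc _,
      hre (L g) H W hHe hW hc, (hL g).2.2 _ hWp]
  -- `f` equals `G - H` only almost everywhere; the exceptional null set is pulled back along every
  -- iterate.
  have hsets : μ.real {x | u ≤ (Finset.range (n + 1)).sup' Finset.nonempty_range_add_one
      (fun i => |birkhoffSum T f i x|)} =
      μ.real {x | u ≤ (Finset.range (n + 1)).sup' Finset.nonempty_range_add_one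
        (fun i => |birkhoffSum T (fun x => G x - H x) i x|)} := by
    refine measureReal_congr ?_
    have hall : ∀ᵐ x ∂μ, ∀ k, f (T^[k] x) = G (T^[k] x) - H (T^[k] x) :=
      ae_all_iff.2 fun k => (hT.iterate k).quasiMeasurePreserving.ae hff
    filter_upwards [hall] with x hx
    have : ∀ i, birkhoffSum T f i x = birkhoffSum T (fun x => G x - H x) i x := fun i =>
      Finset.sum_congr rfl fun k _ => hx k
    refine propext ?_
    change u ≤ _ ↔ u ≤ _
    simp only [this]
  have hφf' : ∀ᵐ x ∂μ, ι φ x = ((G x - H x : ℝ) : ℂ) := by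
    filter_upwards [hφf, hff] with x h1 h2
    rw [h1, h2]
  have hint : ∫ x, (G x - H x) ∂μ = 0 := by rw [← integral_congr_ae hff, hf0]
  have habs : ∫ x, |G x - H x| ∂μ = ∫ x, |f x| ∂μ := integral_congr_ae (by
    filter_upwards [hff] with x hx
    rw [hx])
  have b1 := hexp φ (fun x => G x - H x) (hGm.sub hHm) hφf' hint t (by rwa [abs_of_nonneg ht]) n
  have b2 := hexp φ (fun x => G x - H x) (hGm.sub hHm) hφf' hint (-t) (by rwa [abs_neg, abs_of_nonneg ht]) n
  rw [neg_sq] at b2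
  rw [habs] at b1 b2
  rw [hsets]
  refine (measureReal_le_sup'_abs_birkhoffSum_le hT hGm hHm hGb (fun x => (hHb x).trans hLg)
    hmart u t ht n).trans (mul_le_mul_of_nonneg_left ?_ (Real.exp_pos _).le)
  linarith

end PropertyC

end DeviationInequality

theorem lemma2p7 {Ω : Type*} [MeasurableSpace Ω] (μ : Measure Ω) (T : Ω → Ω)
    (F : Type*) [NormedRing F] [NormedAlgebra ℂ F] [CompleteSpace F]
    (ι : F →ₗ[ℂ] (Ω →ₘ[μ] ℂ)) (hC : PropertyC μ T F ι) :
    ∃ (K U : ℝ) (N : ℕ), 0 < K ∧ 0 < U ∧ 0 < N ∧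
      ∀ (φ : F) (f : Ω → ℝ), (∀ᵐ x ∂μ, ι φ x = (f x : ℂ)) → ∫ x, f x ∂μ = 0 →
        ∀ u : ℝ, 0 < u → ∀ n : ℕ, N < n →
          μ.real {x | u ≤ (Finset.range (n + 1)).sup' Finset.nonempty_range_add_one
              (fun i => |birkhoffSum T f i x|)} ≤
            K * Real.exp (-U * (u / ‖φ‖) * min (u / (n * ∫ x, |f x| ∂μ)) 1) := by
  obtain ⟨δ, D, M, hδ, hD, hM, hmain⟩ := hC.exists_maximal_exponential_bound
  -- `η ≤ 1 / (4D)` makes the quadratic term at most `t u / 4`, half of the gain `t u / 2`.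
  set η := min δ (1 / (4 * D)) with hη
  have hη0 : 0 < η := lt_min hδ (by positivity)
  have hηD : D * η ≤ 1 / 4 := by
    have h : η ≤ 1 / (4 * D) := min_le_right _ _
    rw [le_div_iff₀ (by positivity)] at h
    linarith
  -- The threshold `1` is arbitrary: the estimate below holds for every `n`.
  refine ⟨2 * Real.exp (4 * M * η), η / 4, 1, by positivity, by positivity, one_pos,
    fun φ f hφf hf0 u hu n _ => ?_⟩
  set I := ∫ x, |f x| ∂μ with hI
  have hI0 : 0 ≤ I := integral_nonneg fun x => abs_nonneg _
  set m := min (u / (n * I)) 1 with hm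
  have hm0 : 0 ≤ m := le_min (by positivity) zero_le_one
  have hmn : m * (n * I) ≤ u := by
    refine (mul_le_mul_of_nonneg_right (min_le_left _ _) (by positivity)).trans ?_
    exact div_mul_le_self_of_nonneg hu.le _
  -- If `‖φ‖` or `n * I` is zero, division by zero yields `t = 0`; the inequalities below still
  -- hold, so no case split is needed.
  set t := η * m / ‖φ‖ with ht
  have ht0 : 0 ≤ t := by positivity
  have htφ : t * ‖φ‖ ≤ η * m :=
    div_mul_le_self_of_nonneg (by positivity) _
  have htη : t * ‖φ‖ ≤ η :=
    htφ.trans (mul_le_of_le_one_right hη0.le (min_le_right _ _))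
  refine (hmain φ f hφf hf0 u t ht0 (htη.trans (min_le_left _ _)) n).trans ?_
  rw [mul_left_comm (Real.exp _), ← Real.exp_add, mul_assoc 2, ← Real.exp_add]
  refine mul_le_mul_of_nonneg_left (Real.exp_le_exp.2 ?_) zero_le_two
  have e1 : 4 * t * (M * ‖φ‖) ≤ 4 * M * η := by
    calc 4 * t * (M * ‖φ‖) = 4 * M * (t * ‖φ‖) := by ring
      _ ≤ _ := mul_le_mul_of_nonneg_left htη (by positivity)
  have e2 : n * (D * t ^ 2 * ‖φ‖ * I) ≤ t * u / 4 := by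
    calc n * (D * t ^ 2 * ‖φ‖ * I) = D * t * (n * I) * (t * ‖φ‖) := by ring
      _ ≤ D * t * (n * I) * (η * m) := mul_le_mul_of_nonneg_left htφ (by positivity)
      _ = (D * η) * t * (m * (n * I)) := by ring
      _ ≤ (1 / 4) * t * u := mul_le_mul (mul_le_mul_of_nonneg_right hηD ht0) hmn
          (by positivity) (by positivity)
      _ = _ := by ring
  have e3 : -(η / 4) * (u / ‖φ‖) * m = -(t * u / 4) := by rw [ht]; ring
  rw [e3]
  linarith
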